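/- Consider, for each sample size $n$, the linear model with one possible change at a given observation $k=k_n$: $Y_i=X_i^t\beta^0+\varepsilon_i$ for $1\le i\le k$ and $Y_i=X_i^t\beta_2^0+\varepsilon_i$ for $k<i\le n$, where the $X_i=(X_{i,1},\dots,X_{i,p})^t\in\mathbb R^p$ are deterministic (the dimension $p=p_n$, the design and the coefficients may depend on $n$), $p_n\to\infty$, $\theta=k/n\to\theta^0\in(0,1)$, and the errors $\varepsilon_i$ are i.i.d. with mean zero and finite variance. Put $z_i(\beta)=X_i(Y_i-X_i^t\beta)$, $z_i^0=X_i\varepsilon_i$, $$\psi_n^0=\frac1{n\theta}\sum_{i=1}^k z_i^0-\frac1{n(1-\theta)}\sum_{j=k+1}^n z_j^0,\qquad V_n^0=\frac1{n\theta^2}\sum_{i=1}^k \mathrm{Var}(z_i^0)+\frac1{n(1-\theta)^2}\sum_{j=k+1}^n \mathrm{Var}(z_j^0).$$ A Lagrange multiplier at $\beta$ is a vector $\lambda\in\mathbb R^p$ with $\theta+\lambda^t z_i(\beta)>0$ for $i\le k$, $1-\theta-\lambda^t z_j(\beta)>0$ for $k<j\le n$, and $$\sum_{i=1}^k\frac{z_i(\beta)}{\theta+\lambda^t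 z_i(\beta)}-\sum_{j=k+1}^n\frac{z_j(\beta)}{1-\theta-\lambda^t z_j(\beta)}=0 .$$ Assume that, for some real constant $q\ge4$ and positive constants $C_0,C_1,C_3,C_4$: (A1) for all large $n$, every eigenvalue of $V_n^0$ lies in $(C_0,C_1)$; (A3) $p^{-1}\sum_{s=1}^p|X_{i,s}|^q<C_3$ for all $n$ and $1\le i\le n$; (A4) $E|\varepsilon_1|^{2q}<C_4$; (A5) $p\,k^{(2-q)/(2q)}\to0$ and $p\,(n-k)^{(2-q)/(2q)}\to0$ as $n\to\infty$; (A6) $p^{2+4/q}k^{-1}\to0$ and $p^{2+4/q}(n-k)^{-1}\to0$ as $n\to\infty$. Then, under the null hypothesis $H_0:\beta_2^0=\beta^0$, a Lagrange multiplier at $\beta^0$ exists with probability tending to one as $n\to\infty$, and if $\lambda=\lambda_n$ is a Lagrange multiplier at $\beta^0$ whenever one exists (and arbitrary otherwise), then $$\lambda=(V_n^0)^{-1}\psi_n^0\,(1+o_P(1)),$$ that is, for every $\delta>0$, $P\big(\|\lambda-(V_n^0)^{-1}\psi_n^0\|>\delta\,\|(V_n^0)^{-1}\psi_n^0\|\big)\to0$,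 where $\|\cdot\|$ is the Euclidean norm. -/

import Mathlib

open Filter Topology MeasureTheory ProbabilityTheory

namespace TwoSampleEL

/-- Response `Y_i` of the two-phase linear model with change-point `k`: the coefficient vector is
`β` on the first `k` observations and `β₂` on the later ones. Observations are numbered from `0`,
so the first phase is `{0, …, k - 1}` and the second phase is `{k, …, n - 1}`. -/
noncomputable def response {d : ℕ} (k : ℕ) (X : ℕ → EuclideanSpace ℝ (Fin d))
    (β β₂ : EuclideanSpace ℝ (Fin d)) (e : ℕ → ℝ) (i : ℕ) : ℝ :=
  inner ℝ (X i) (if i < k then β else β₂) + e i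

/-- `z_i(β) = X_i (Y_i - X_iᵗ β)`. -/
noncomputable def z {d : ℕ} (X : ℕ → EuclideanSpace ℝ (Fin d)) (Y : ℕ → ℝ)
    (β : EuclideanSpace ℝ (Fin d)) (i : ℕ) : EuclideanSpace ℝ (Fin d) :=
  (Y i - inner ℝ (X i) β) • X i

/-- `z_i⁰ = X_i ε_i`. -/
noncomputable def z0 {d : ℕ} (X : ℕ → EuclideanSpace ℝ (Fin d)) (e : ℕ → ℝ) (i : ℕ) :
    EuclideanSpace ℝ (Fin d) :=
  e i • X i

/-- `l` is a Lagrange multiplier for the vectors `z_0, …, z_{n-1}` and the change-point `k`: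
the denominators (multiples of the inverses of the probabilities attached to the observations)
are positive, and the multiplier equation holds, with `θ = k / n`. -/
def IsMultiplier {d : ℕ} (n k : ℕ) (z : ℕ → EuclideanSpace ℝ (Fin d))
    (l : EuclideanSpace ℝ (Fin d)) : Prop :=
  (∀ i ∈ Finset.range k, 0 < (k : ℝ) / n + inner ℝ l (z i)) ∧
  (∀ j ∈ Finset.Ico k n, 0 < 1 - (k : ℝ) / n - inner ℝ l (z j)) ∧
  (∑ i ∈ Finset.range k, ((k : ℝ) / n + inner ℝ l (z i))⁻¹ • z i) -
    (∑ j ∈ Finset.Ico k n, (1 - (k : ℝ) / n - inner ℝ l (z j))⁻¹ • z j) = 0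

/-- `ψ_n = (n θ)⁻¹ ∑_{first phase} z_i - (n (1 - θ))⁻¹ ∑_{second phase} z_j`, `θ = k / n`. -/
noncomputable def psi {d : ℕ} (n k : ℕ) (z : ℕ → EuclideanSpace ℝ (Fin d)) :
    EuclideanSpace ℝ (Fin d) :=
  ((n : ℝ) * ((k : ℝ) / n))⁻¹ • (∑ i ∈ Finset.range k, z i) -
    ((n : ℝ) * (1 - (k : ℝ) / n))⁻¹ • (∑ j ∈ Finset.Ico k n, z j)

/-- Variance matrix of a random vector of `ℝ^d`. -/
noncomputable def varMatrix {Ω : Type*} [MeasurableSpace Ω] (P : Measure Ω) {d : ℕ}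
    (v : Ω → EuclideanSpace ℝ (Fin d)) : Matrix (Fin d) (Fin d) ℝ :=
  Matrix.of fun s t => cov[fun ω => v ω s, fun ω => v ω t; P]

/-- `V_n⁰ = (n θ²)⁻¹ ∑_{first phase} Var(z_i⁰) + (n (1 - θ)²)⁻¹ ∑_{second phase} Var(z_j⁰)`,
`θ = k / n`. -/
noncomputable def V0 {Ω : Type*} [MeasurableSpace Ω] (P : Measure Ω) {d : ℕ} (n k : ℕ)
    (X : ℕ → EuclideanSpace ℝ (Fin d)) (ε : ℕ → Ω → ℝ) : Matrix (Fin d) (Fin d) ℝ :=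
  ((n : ℝ) * ((k : ℝ) / n) ^ 2)⁻¹ •
      (∑ i ∈ Finset.range k, varMatrix P fun ω => z0 X (fun m => ε m ω) i) +
    ((n : ℝ) * (1 - (k : ℝ) / n) ^ 2)⁻¹ •
      (∑ j ∈ Finset.Ico k n, varMatrix P fun ω => z0 X (fun m => ε m ω) j)

/-- `u_n = v_n (1 + o_P(1))` for random vectors of (possibly varying) normed spaces:
`‖u_n - v_n‖ ≤ δ ‖v_n‖` with probability tending to one, for every `δ > 0`. No measurability of
`u_n` or `v_n` is needed: `P` of an arbitrary set is its outer measure. -/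
def EqOneAddLittleOP {Ω : Type*} [MeasurableSpace Ω] (P : Measure Ω) {E : ℕ → Type*}
    [∀ n, NormedAddCommGroup (E n)] (u v : (n : ℕ) → Ω → E n) : Prop :=
  ∀ δ : ℝ, 0 < δ →
    Tendsto (fun n => P {ω | δ * ‖v n ω‖ < ‖u n ω - v n ω‖}) atTop (𝓝 0)

end TwoSampleEL

namespace TwoSampleEL

/-! Put a_i = c_i X_i, with c_i = 1/θ on the first phase and -1/(1-θ) on the second, and w_i = ε_i
a_i. Under the null hypothesis the two-phase equation becomes the one-sample equation ∑ w_i / (1 +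
⟪l, w_i⟫) = 0, `ψ` is the mean of the w_i, and V_n⁰ is the expected value of their empirical
second-moment matrix S. The rest is deterministic once M‖ψ‖ and S - V_n⁰ are small, where M bounds
every ‖w_i‖. A solution is an interior maximiser of ∑ log(1 + ⟪l, w_i⟫) on a small ball
(`exists_isTilt`). Every solution is O(‖ψ‖) (`IsTilt.norm_le`), and expanding 1/(1 + t) gives S l =
ψ + R with R negligible, hence l ≈ (V_n⁰)⁻¹ψ (`IsTilt.norm_sub_le`). Smallness is probabilistic: the
2q-th moment gives max |ε_i| ≤ n^(1/q), so M = O(√p n^(1/q)); second moments give ‖ψ‖ = O_P(√(p/n))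
and a Frobenius error O_P(p/√n). All of this is controlled by p n^((2-q)/(2q)), which tends to 0. -/

theorem log_one_add_le_sub_sq {x : ℝ} (hx : |x| ≤ 1 / 5) :
    Real.log (1 + x) ≤ x - x ^ 2 / 4 := by
  have h := Real.abs_log_sub_add_sum_range_le (x := -x) (by rw [abs_neg]; linarith) 2
  rw [abs_neg, Finset.sum_range_succ, Finset.sum_range_one, sub_neg_eq_add] at h
  -- For |x| ≤ 1/5 one has |x|/(1-|x|) ≤ 1/4, so the remainder costs at most half of the quadratic
  -- term x²/2.
  have h3 : |x| ^ (2 + 1) / (1 - |x|) ≤ x ^ 2 / 4 := by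
    rw [div_le_iff₀ (by linarith), ← sq_abs x]
    have := abs_nonneg x
    nlinarith [sq_nonneg |x|]
  have h4 := (abs_le.mp (h.trans h3)).2
  norm_num at h4
  linarith

/-! ### Deterministic analysis of the one-sample multiplier equation -/

section Deterministic

variable {ι E : Type*} [NormedAddCommGroup E] [InnerProductSpace ℝ E]

/-- The vectors `w_i` carry a positive reweighting `(1 + ⟪l, w_i⟫)⁻¹` with zero barycentre. -/
def IsTilt (s : Finset ι) (w : ι → E) (l : E) : Prop :=
  (∀ i ∈ s, 0 < 1 + inner ℝ l (w i)) ∧ ∑ i ∈ s, (1 + inner ℝ l (w i))⁻¹ • w i = 0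

/-- The log-likelihood vanishes at 0 and is negative on the sphere of radius r, so its maximum over
the ball is attained inside, where the gradient is zero. -/
theorem exists_isTilt [FiniteDimensional ℝ E] {s : Finset ι} {w : ι → E} {N M c : ℝ} {ψ : E}
    (hN : 0 < N) (hc : 0 < c) (hψ : ∑ i ∈ s, w i = N • ψ) (hM : ∀ i ∈ s, ‖w i‖ ≤ M)
    (hMψ : M * ‖ψ‖ ≤ c / 25) (hS : ∀ x : E, N * (c * ‖x‖ ^ 2) ≤ ∑ i ∈ s, inner ℝ x (w i) ^ 2) :
    ∃ l, IsTilt s w l := by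
  rcases eq_or_ne ψ 0 with h0 | h0
  · exact ⟨0, by simp, by simp [hψ, h0]⟩
  have hψ0 : 0 < ‖ψ‖ := norm_pos_iff.mpr h0
  -- On the sphere the likelihood is at most N(r‖ψ‖ - c r²/4), negative as soon as r > 4‖ψ‖/c. With
  -- the factor 5, the bound M‖ψ‖ ≤ c/25 is exactly M r ≤ 1/5.
  set r := 5 * ‖ψ‖ / c with hr
  have hr0 : 0 < r := by positivity
  have hin : ∀ l ∈ Metric.closedBall (0 : E) r, ∀ i ∈ s, |inner ℝ l (w i)| ≤ 1 / 5 := by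
    intro l hl i hi
    rw [mem_closedBall_zero_iff] at hl
    calc |inner ℝ l (w i)| ≤ ‖l‖ * ‖w i‖ := abs_real_inner_le_norm _ _
      _ ≤ r * M := mul_le_mul hl (hM i hi) (norm_nonneg _) hr0.le
      _ = 5 * (M * ‖ψ‖) / c := by rw [hr]; ring
      _ ≤ 1 / 5 := by rw [div_le_iff₀ hc]; linarith
  have hpos : ∀ l ∈ Metric.closedBall (0 : E) r, ∀ i ∈ s, 0 < 1 + inner ℝ l (w i) := by
    intro l hl i hi
    have := (abs_le.mp (hin l hl i hi)).1
    linarith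
  let f : E → ℝ := fun l => ∑ i ∈ s, Real.log (1 + inner ℝ l (w i))
  have hfc : ContinuousOn f (Metric.closedBall 0 r) := by
    refine continuousOn_finsetSum _ fun i hi => ContinuousOn.log (by fun_prop) ?_
    exact fun l hl => (hpos l hl i hi).ne'
  obtain ⟨l, hl, hmax⟩ := (isCompact_closedBall (0 : E) r).exists_isMaxOn
    ⟨0, by simp [hr0.le]⟩ hfc
  have hf0 : 0 ≤ f l := by
    have := hmax (show (0 : E) ∈ Metric.closedBall 0 r by simp [hr0.le])
    simpa [f] using this
  have hlr : ‖l‖ < r := by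
    refine lt_of_le_of_ne (mem_closedBall_zero_iff.mp hl) fun h => ?_
    have h1 : f l ≤ ∑ i ∈ s, (inner ℝ l (w i) - inner ℝ l (w i) ^ 2 / 4) :=
      Finset.sum_le_sum fun i hi => log_one_add_le_sub_sq (hin l hl i hi)
    rw [Finset.sum_sub_distrib, ← inner_sum, hψ, inner_smul_right, ← Finset.sum_div] at h1
    have h2 := hS l
    have h3 : inner ℝ l ψ ≤ r * ‖ψ‖ := h ▸ real_inner_le_norm l ψ
    rw [h] at h2
    have h4 : c * r ^ 2 = 5 * (r * ‖ψ‖) := by rw [hr]; field_simp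
    rw [h4] at h2
    have h5 : 0 < N * (r * ‖ψ‖) := by positivity
    have h6 := mul_le_mul_of_nonneg_left h3 hN.le
    linarith
  have hloc : IsLocalMax f l := by
    filter_upwards [Metric.isOpen_ball.mem_nhds (mem_ball_zero_iff.mpr hlr)] with y hy
    exact hmax (Metric.ball_subset_closedBall hy)
  have hder : HasFDerivAt f
      (∑ i ∈ s, (1 + inner ℝ l (w i))⁻¹ • (innerSL ℝ (w i) : E →L[ℝ] ℝ)) l := by
    refine HasFDerivAt.fun_sum fun i hi => HasFDerivAt.log ?_ (hpos l hl i hi).ne'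
    have h : HasFDerivAt (fun y => 1 + innerSL ℝ (w i) y) (innerSL ℝ (w i) : E →L[ℝ] ℝ) l :=
      (innerSL ℝ (w i)).hasFDerivAt.const_add 1
    refine h.congr_of_eventuallyEq (Eventually.of_forall fun y => ?_)
    simp [real_inner_comm]
  refine ⟨l, hpos l hl, ?_⟩
  have h : ∀ v, inner ℝ (∑ i ∈ s, (1 + inner ℝ l (w i))⁻¹ • w i) v = 0 := fun v => by
    simpa [sum_inner, real_inner_smul_left] using
      DFunLike.congr_fun (hloc.hasFDerivAt_eq_zero hder) v
  exact inner_self_eq_zero.mp (h _)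

/-- Pairing the equation with l gives ∑ ⟪l, w_i⟫²/(1 + ⟪l, w_i⟫) = N⟪l, ψ⟫, and the denominators are
at most 1 + ‖l‖M. Hence c‖l‖ ≤ ‖ψ‖ + ‖l‖M‖ψ‖, whose last term is absorbed on the left. No prior
smallness of l is assumed, so this covers every multiplier. -/
theorem IsTilt.norm_le {s : Finset ι} {w : ι → E} {N M c : ℝ} {ψ l : E} (hl : IsTilt s w l)
    (hN : 0 < N) (hc : 0 < c) (hM0 : 0 ≤ M)
    (hψ : ∑ i ∈ s, w i = N • ψ) (hM : ∀ i ∈ s, ‖w i‖ ≤ M)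
    (hMψ : M * ‖ψ‖ ≤ c / 25) (hS : ∀ x : E, N * (c * ‖x‖ ^ 2) ≤ ∑ i ∈ s, inner ℝ x (w i) ^ 2) :
    ‖l‖ ≤ 2 * ‖ψ‖ / c := by
  rcases eq_or_ne l 0 with h0 | h0
  · rw [h0, norm_zero]; positivity
  have hl0 : 0 < ‖l‖ := norm_pos_iff.mpr h0
  have hB : 0 < 1 + ‖l‖ * M := by positivity
  have h1 : ∑ i ∈ s, inner ℝ l (w i) ^ 2 / (1 + inner ℝ l (w i)) = N * inner ℝ l ψ := by
    have h := congrArg (inner ℝ l) hl.2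
    rw [inner_sum, inner_zero_right] at h
    rw [← inner_smul_right, ← hψ, inner_sum, ← sub_zero (∑ i ∈ s, inner ℝ l (w i)), ← h,
      ← Finset.sum_sub_distrib]
    refine Finset.sum_congr rfl fun i hi => ?_
    have := (hl.1 i hi).ne'
    rw [inner_smul_right]
    field_simp
    ring
  have h2 : (∑ i ∈ s, inner ℝ l (w i) ^ 2) / (1 + ‖l‖ * M) ≤ N * inner ℝ l ψ := by
    rw [← h1, Finset.sum_div]
    refine Finset.sum_le_sum fun i hi => div_le_div_of_nonneg_left (sq_nonneg _) (hl.1 i hi) ?_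
    have := (real_inner_le_norm l (w i)).trans
      (mul_le_mul_of_nonneg_left (hM i hi) (norm_nonneg l))
    linarith
  rw [div_le_iff₀ hB] at h2
  have h3 : N * (c * ‖l‖ ^ 2) ≤ N * (‖l‖ * ‖ψ‖ * (1 + ‖l‖ * M)) := by
    refine (hS l).trans (h2.trans ?_)
    rw [mul_assoc]
    gcongr
    exact real_inner_le_norm l ψ
  have h4 : ‖l‖ * (c * ‖l‖) ≤ ‖l‖ * (‖ψ‖ * (1 + ‖l‖ * M)) := by
    have := le_of_mul_le_mul_left h3 hN
    linarith
  have h5 := le_of_mul_le_mul_left h4 hl0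
  have h6 : ‖l‖ * (M * ‖ψ‖) ≤ ‖l‖ * (c / 25) := by gcongr
  rw [le_div_iff₀ hc]
  nlinarith

/-- From 1/(1+t) = 1 - t + t²/(1+t) the equation reads S = ψ + R, so T(l - u) = -(S - T l) + R; both
terms are O(η‖ψ‖), and the bounds on T convert this into a multiple of ‖u‖. -/
theorem IsTilt.norm_sub_le {s : Finset ι} {w : ι → E} {N M C₀ C₁ η : ℝ} {ψ l u : E}
    {T : E →ₗ[ℝ] E} (hl : IsTilt s w l)
    (hN : 0 < N) (hC₀ : 0 < C₀) (hC₁ : 0 ≤ C₁) (hM0 : 0 ≤ M) (hη : η ≤ C₀ / 50) (hη1 : η ≤ 1)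
    (hψ : ∑ i ∈ s, w i = N • ψ) (hM : ∀ i ∈ s, ‖w i‖ ≤ M)
    (hMψ : M * ‖ψ‖ ≤ η) (hS : ∀ x : E, N * (C₀ / 2 * ‖x‖ ^ 2) ≤ ∑ i ∈ s, inner ℝ x (w i) ^ 2)
    (hST : ∀ x : E, ‖N⁻¹ • (∑ i ∈ s, inner ℝ x (w i) • w i) - T x‖ ≤ η * ‖x‖)
    (hT₀ : ∀ x, C₀ * ‖x‖ ≤ ‖T x‖) (hT₁ : ∀ x, ‖T x‖ ≤ C₁ * ‖x‖) (hu : T u = ψ) :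
    ‖l - u‖ ≤ (4 / C₀ + 32 * (C₁ + 1) / C₀ ^ 2) * C₁ / C₀ * η * ‖u‖ := by
  have hη0 : 0 ≤ η := (by positivity : 0 ≤ M * ‖ψ‖).trans hMψ
  have hlψ : ‖l‖ ≤ 4 * ‖ψ‖ / C₀ := by
    refine (hl.norm_le hN (half_pos hC₀) hM0 hψ hM (by linarith) hS).trans_eq ?_
    field_simp
    ring
  have hlM : ‖l‖ * M ≤ 1 / 2 := by
    calc ‖l‖ * M ≤ 4 * ‖ψ‖ / C₀ * M := by gcongr
      _ = 4 * (M * ‖ψ‖) / C₀ := by ring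
      _ ≤ 1 / 2 := by rw [div_le_iff₀ hC₀]; linarith
  have hden : ∀ i ∈ s, 1 / 2 ≤ 1 + inner ℝ l (w i) := by
    intro i hi
    have := (abs_le.mp ((abs_real_inner_le_norm l (w i)).trans
      (mul_le_mul_of_nonneg_left (hM i hi) (norm_nonneg l)))).1
    linarith
  set R : E := N⁻¹ • ∑ i ∈ s, (inner ℝ l (w i) ^ 2 / (1 + inner ℝ l (w i))) • w i with hR
  set S : E := N⁻¹ • (∑ i ∈ s, inner ℝ l (w i) • w i) with hSdef
  have hexp : S = ψ + R := by
    have h1 : ψ = N⁻¹ • ∑ i ∈ s, w i := by rw [hψ, inv_smul_smul₀ hN.ne']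
    rw [h1, hR, hSdef, ← smul_add, ← Finset.sum_add_distrib]
    congr 1
    rw [← add_zero (∑ i ∈ s, inner ℝ l (w i) • w i), ← hl.2, ← Finset.sum_add_distrib]
    refine Finset.sum_congr rfl fun i hi => ?_
    have := (hl.1 i hi).ne'
    have h2 : inner ℝ l (w i) + (1 + inner ℝ l (w i))⁻¹ =
        1 + inner ℝ l (w i) ^ 2 / (1 + inner ℝ l (w i)) := by
      field_simp
      ring
    rw [← add_smul, h2, add_smul, one_smul]
  have hSn : ‖S‖ ≤ (C₁ + 1) * ‖l‖ := by
    calc ‖S‖ = ‖(S - T l) + T l‖ := by rw [sub_add_cancel]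
      _ ≤ ‖S - T l‖ + ‖T l‖ := norm_add_le _ _
      _ ≤ η * ‖l‖ + C₁ * ‖l‖ := add_le_add (hST l) (hT₁ l)
      _ ≤ (C₁ + 1) * ‖l‖ := by nlinarith [norm_nonneg l]
  -- Bounding one factor ‖w_i‖ by M leaves the quadratic form ⟪l, S⟫, so no third moment is needed;
  -- the 2 comes from denominators ≥ 1/2.
  have hRn : ‖R‖ ≤ 2 * M * (inner ℝ l S) := by
    rw [hR, hSdef, norm_smul, Real.norm_of_nonneg (inv_nonneg.mpr hN.le), inner_smul_right,
      inner_sum, mul_left_comm, Finset.mul_sum]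
    gcongr
    refine (norm_sum_le _ _).trans (Finset.sum_le_sum fun i hi => ?_)
    have h1 := hden i hi
    have h2 : 0 < 1 + inner ℝ l (w i) := by linarith
    rw [norm_smul, Real.norm_of_nonneg (by positivity), inner_smul_right]
    calc inner ℝ l (w i) ^ 2 / (1 + inner ℝ l (w i)) * ‖w i‖
        ≤ (inner ℝ l (w i) ^ 2 / (1 / 2)) * M := by gcongr; exact hM i hi
      _ = _ := by ring
  have hRn' : ‖R‖ ≤ 32 * (C₁ + 1) / C₀ ^ 2 * η * ‖ψ‖ := by
    calc ‖R‖ ≤ 2 * M * (‖l‖ * ((C₁ + 1) * ‖l‖)) := by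
          refine hRn.trans ?_
          gcongr
          exact (real_inner_le_norm _ _).trans (by gcongr)
      _ = 2 * (C₁ + 1) * M * ‖l‖ ^ 2 := by ring
      _ ≤ 2 * (C₁ + 1) * M * (4 * ‖ψ‖ / C₀) ^ 2 := by gcongr
      _ = 32 * (C₁ + 1) / C₀ ^ 2 * (M * ‖ψ‖) * ‖ψ‖ := by field_simp; ring
      _ ≤ _ := by gcongr
  have hmain : C₀ * ‖l - u‖ ≤ (4 / C₀ + 32 * (C₁ + 1) / C₀ ^ 2) * η * ‖ψ‖ := by
    refine (hT₀ _).trans ?_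
    have h1 : T (l - u) = -(S - T l) + R := by rw [map_sub, hu, hexp]; abel
    rw [h1]
    refine (norm_add_le _ _).trans ?_
    rw [norm_neg]
    have h2 : ‖S - T l‖ ≤ η * (4 * ‖ψ‖ / C₀) := (hST l).trans (by gcongr)
    calc _ ≤ η * (4 * ‖ψ‖ / C₀) + 32 * (C₁ + 1) / C₀ ^ 2 * η * ‖ψ‖ := add_le_add h2 hRn'
      _ = _ := by ring
  have hψu : ‖ψ‖ ≤ C₁ * ‖u‖ := hu ▸ hT₁ u
  calc ‖l - u‖ ≤ (4 / C₀ + 32 * (C₁ + 1) / C₀ ^ 2) * η * ‖ψ‖ / C₀ := by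
        rw [le_div_iff₀ hC₀]; linarith
    _ ≤ (4 / C₀ + 32 * (C₁ + 1) / C₀ ^ 2) * η * (C₁ * ‖u‖) / C₀ := by gcongr
    _ = _ := by ring

theorem quadratic_form_lower_bound {s : Finset ι} {w : ι → E} {N C₀ η : ℝ} {T : E →ₗ[ℝ] E}
    (hN : 0 < N) (hη : η ≤ C₀ / 2)
    (hST : ∀ x : E, ‖N⁻¹ • (∑ i ∈ s, inner ℝ x (w i) • w i) - T x‖ ≤ η * ‖x‖)
    (hT₀ : ∀ x, C₀ * ‖x‖ ^ 2 ≤ inner ℝ x (T x)) (x : E) :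
    N * (C₀ / 2 * ‖x‖ ^ 2) ≤ ∑ i ∈ s, inner ℝ x (w i) ^ 2 := by
  have h1 : inner ℝ x (N⁻¹ • (∑ i ∈ s, inner ℝ x (w i) • w i)) =
      N⁻¹ * ∑ i ∈ s, inner ℝ x (w i) ^ 2 := by
    simp only [inner_smul_right, inner_sum, sq]
  have h2 := (abs_le.mp ((abs_real_inner_le_norm x _).trans
    (mul_le_mul_of_nonneg_left (hST x) (norm_nonneg x)))).1
  rw [inner_sub_right, h1] at h2
  have h3 : C₀ / 2 * ‖x‖ ^ 2 ≤ N⁻¹ * ∑ i ∈ s, inner ℝ x (w i) ^ 2 := by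
    have := mul_le_mul_of_nonneg_right hη (sq_nonneg ‖x‖)
    have := hT₀ x
    nlinarith
  rwa [← div_eq_inv_mul, le_div_iff₀ hN, mul_comm] at h3

end Deterministic

/-! ### Eigenvalue bounds for symmetric operators -/

section Spectral

variable {E : Type*} [NormedAddCommGroup E] [InnerProductSpace ℝ E] [FiniteDimensional ℝ E]

theorem _root_.LinearMap.IsSymmetric.le_inner_of_eigenvalues {T : E →ₗ[ℝ] E} (hT : T.IsSymmetric)
    {c : ℝ} (h : ∀ μ : ℝ, Module.End.HasEigenvalue T μ → c ≤ μ) (x : E) :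
    c * ‖x‖ ^ 2 ≤ inner ℝ x (T x) := by
  let b := hT.eigenvectorBasis rfl
  rw [← b.sum_inner_mul_inner x (T x), ← b.sum_sq_norm_inner_right x, Finset.mul_sum]
  refine Finset.sum_le_sum fun i _ => ?_
  have h1 : inner ℝ (b i) (T x) = hT.eigenvalues rfl i * inner ℝ (b i) x := by
    rw [← hT (b i) x, hT.apply_eigenvectorBasis, real_inner_smul_left]
    rfl
  have h2 := h _ (hT.hasEigenvalue_eigenvalues rfl i)
  have hcomm : inner ℝ x (b i) = inner ℝ (b i) x := real_inner_comm _ _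
  rw [h1, hcomm, Real.norm_eq_abs, sq_abs]
  have h3 := mul_le_mul_of_nonneg_right h2 (sq_nonneg (inner ℝ (b i) x))
  refine h3.trans_eq ?_
  rw [RCLike.ofReal_real_eq_id, id]
  ring

theorem _root_.LinearMap.IsSymmetric.norm_apply_le_of_eigenvalues {T : E →ₗ[ℝ] E}
    (hT : T.IsSymmetric) {C : ℝ} (hC : 0 ≤ C)
    (h : ∀ μ : ℝ, Module.End.HasEigenvalue T μ → |μ| ≤ C) (x : E) :
    ‖T x‖ ≤ C * ‖x‖ := by
  let b := hT.eigenvectorBasis rfl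
  refine abs_le_of_sq_le_sq' ?_ (by positivity) |>.2
  rw [mul_pow, ← b.sum_sq_norm_inner_right x, ← b.sum_sq_norm_inner_right (T x), Finset.mul_sum]
  refine Finset.sum_le_sum fun i _ => ?_
  have h1 : inner ℝ (b i) (T x) = hT.eigenvalues rfl i * inner ℝ (b i) x := by
    rw [← hT (b i) x, hT.apply_eigenvectorBasis, real_inner_smul_left]
    rfl
  have h2 := h _ (hT.hasEigenvalue_eigenvalues rfl i)
  rw [h1, norm_mul, mul_pow]
  gcongr
  simpa using h2

end Spectral

/-! ### Second moments of vector-valued sums -/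

section SecondMoment

variable {Ω : Type*} [MeasurableSpace Ω] {P : Measure Ω}
  {E : Type*} [NormedAddCommGroup E] [InnerProductSpace ℝ E]

/-- Cross terms vanish by pairwise independence and centring. The coefficients b_i lie in a general
E because the bound serves both for `ψ` in ℝ^d and for matrices in ℝ^(d×d). -/
theorem integral_norm_sum_smul_sq {ξ : ℕ → Ω → ℝ} {τ : ℝ} (hL : ∀ i, MemLp (ξ i) 2 P)
    (h0 : ∀ i, ∫ ω, ξ i ω ∂P = 0) (hτ : ∀ i, ∫ ω, ξ i ω ^ 2 ∂P = τ)
    (hind : Pairwise fun i j => IndepFun (ξ i) (ξ j) P) (s : Finset ℕ) (b : ℕ → E) :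
    Integrable (fun ω => ‖∑ i ∈ s, ξ i ω • b i‖ ^ 2) P ∧
    ∫ ω, ‖∑ i ∈ s, ξ i ω • b i‖ ^ 2 ∂P = τ * ∑ i ∈ s, ‖b i‖ ^ 2 := by
  have hexp : (fun ω => ‖∑ i ∈ s, ξ i ω • b i‖ ^ 2) =
      fun ω => ∑ i ∈ s, ∑ j ∈ s, ξ i ω * ξ j ω * inner ℝ (b i) (b j) := by
    ext ω
    rw [← real_inner_self_eq_norm_sq, sum_inner]
    refine Finset.sum_congr rfl fun i _ => ?_
    rw [inner_sum]
    refine Finset.sum_congr rfl fun j _ => ?_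
    rw [real_inner_smul_left, real_inner_smul_right]
    ring
  have hint : ∀ i j, Integrable (fun ω => ξ i ω * ξ j ω * inner ℝ (b i) (b j)) P :=
    fun i j => ((hL i).integrable_mul (hL j)).mul_const _
  rw [hexp]
  refine ⟨integrable_finsetSum _ fun i _ => integrable_finsetSum _ fun j _ => hint i j, ?_⟩
  rw [integral_finsetSum _ fun i _ => integrable_finsetSum _ fun j _ => hint i j,
    Finset.mul_sum]
  refine Finset.sum_congr rfl fun i hi => ?_
  rw [integral_finsetSum _ fun j _ => hint i j, Finset.sum_eq_single i]
  · rw [integral_mul_const, real_inner_self_eq_norm_sq, ← hτ i]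
    simp only [sq]
  · intro j _ hj
    rw [integral_mul_const, (hind hj.symm).integral_fun_mul_eq_mul_integral
      (hL i).1 (hL j).1, h0 i, zero_mul, zero_mul]
  · exact fun h => absurd hi h

theorem measure_lt_norm_sum_smul_le [IsFiniteMeasure P] {ξ : ℕ → Ω → ℝ} {τ : ℝ} (hL : ∀ i, MemLp (ξ i) 2 P)
    (h0 : ∀ i, ∫ ω, ξ i ω ∂P = 0) (hτ : ∀ i, ∫ ω, ξ i ω ^ 2 ∂P = τ)
    (hind : Pairwise fun i j => IndepFun (ξ i) (ξ j) P) (s : Finset ℕ) (b : ℕ → E) {c : ℝ}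
    (hc : 0 < c) :
    P {ω | c < ‖∑ i ∈ s, ξ i ω • b i‖} ≤ ENNReal.ofReal (τ * (∑ i ∈ s, ‖b i‖ ^ 2) / c ^ 2) := by
  obtain ⟨hi, he⟩ := integral_norm_sum_smul_sq hL h0 hτ hind s b
  have h := mul_meas_ge_le_integral_of_nonneg (Eventually.of_forall fun ω => by positivity) hi
    (c ^ 2)
  rw [he] at h
  have hsub : {ω | c < ‖∑ i ∈ s, ξ i ω • b i‖} ⊆ {ω | c ^ 2 ≤ ‖∑ i ∈ s, ξ i ω • b i‖ ^ 2} :=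
    fun ω (hω : c < _) => by
      show c ^ 2 ≤ _
      gcongr
  refine (measure_mono hsub).trans ?_
  rw [ENNReal.le_ofReal_iff_toReal_le (measure_ne_top _ _), le_div_iff₀ (by positivity), mul_comm]
  · exact h
  · have : 0 ≤ τ := by rw [← hτ 0]; positivity
    positivity

end SecondMoment

/-! ### Reduction of the two-phase model to one sample -/

section Model

/-- Factor turning the two-phase multiplier equation into a one-sample one. -/
noncomputable def phaseWeight (n k i : ℕ) : ℝ :=
  if i < k then ((k : ℝ) / n)⁻¹ else -(1 - (k : ℝ) / n)⁻¹

theorem sum_phases {M : Type*} [AddCommMonoid M] {n k : ℕ} (hkn : k ≤ n) (f : ℝ → ℕ → M) :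
    ∑ i ∈ Finset.range n, f (phaseWeight n k i) i =
      (∑ i ∈ Finset.range k, f ((k : ℝ) / n)⁻¹ i) +
        ∑ j ∈ Finset.Ico k n, f (-(1 - (k : ℝ) / n)⁻¹) j := by
  rw [← Finset.sum_range_add_sum_Ico _ hkn]
  congr 1
  · exact Finset.sum_congr rfl fun i hi => by rw [phaseWeight, if_pos (Finset.mem_range.mp hi)]
  · exact Finset.sum_congr rfl fun i hi => by
      rw [phaseWeight, if_neg (Finset.mem_Ico.mp hi).1.not_gt]

/-- Factoring θ or 1 - θ out of each denominator leaves 1 + ⟪l, w_i⟫; the negative weight of the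
second phase absorbs both minus signs. -/
theorem isMultiplier_iff_isTilt {d n k : ℕ} (hk : 0 < k) (hkn : k < n)
    (z : ℕ → EuclideanSpace ℝ (Fin d)) (l : EuclideanSpace ℝ (Fin d)) :
    IsMultiplier n k z l ↔ IsTilt (Finset.range n) (fun i => phaseWeight n k i • z i) l := by
  have hn : (0 : ℝ) < n := by exact_mod_cast hk.trans hkn
  have hθ : 0 < (k : ℝ) / n := div_pos (by exact_mod_cast hk) hn
  have hθ' : 0 < 1 - (k : ℝ) / n := by
    rw [sub_pos, div_lt_one hn]
    exact_mod_cast hkn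
  set θ := (k : ℝ) / n with hθdef
  have h1 : ∀ i, θ + inner ℝ l (z i) = θ * (1 + inner ℝ l (θ⁻¹ • z i)) := fun i => by
    rw [inner_smul_right]; field_simp
  have h2 : ∀ i, 1 - θ - inner ℝ l (z i) =
      (1 - θ) * (1 + inner ℝ l ((-(1 - θ)⁻¹) • z i)) := fun i => by
    rw [inner_smul_right]; field_simp; ring
  have h3 : ∑ i ∈ Finset.range n,
      (1 + inner ℝ l (phaseWeight n k i • z i))⁻¹ • phaseWeight n k i • z i =
      (∑ i ∈ Finset.range k, (θ + inner ℝ l (z i))⁻¹ • z i) -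
        (∑ j ∈ Finset.Ico k n, (1 - θ - inner ℝ l (z j))⁻¹ • z j) := by
    rw [sum_phases hkn.le (fun c i => (1 + inner ℝ l (c • z i))⁻¹ • c • z i), ← hθdef,
      sub_eq_add_neg (∑ i ∈ _, _), ← Finset.sum_neg_distrib]
    congr 1
    · refine Finset.sum_congr rfl fun i _ => ?_
      rw [h1, smul_smul, mul_inv, mul_comm]
    · refine Finset.sum_congr rfl fun i _ => ?_
      rw [h2, smul_smul, mul_inv, ← neg_smul]
      congr 1
      ring
  rw [IsMultiplier, IsTilt, h3, ← and_assoc]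
  refine and_congr_left fun _ => ⟨fun h i hi => ?_, fun h => ⟨fun i hi => ?_, fun i hi => ?_⟩⟩
  · by_cases hik : i < k
    · have := h.1 i (Finset.mem_range.mpr hik)
      rw [h1] at this
      rw [phaseWeight, if_pos hik]
      exact pos_of_mul_pos_right this hθ.le
    · have := h.2 i (Finset.mem_Ico.mpr ⟨not_lt.mp hik, Finset.mem_range.mp hi⟩)
      rw [h2] at this
      rw [phaseWeight, if_neg hik]
      exact pos_of_mul_pos_right this hθ'.le
  · have hik := Finset.mem_range.mp hi
    have := h i (Finset.mem_range.mpr (hik.trans hkn))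
    rw [phaseWeight, if_pos hik] at this
    rw [h1]
    exact mul_pos hθ this
  · have hik := Finset.mem_Ico.mp hi
    have := h i (Finset.mem_range.mpr hik.2)
    rw [phaseWeight, if_neg hik.1.not_gt] at this
    rw [h2]
    exact mul_pos hθ' this

theorem psi_eq_sum {d n k : ℕ} (hkn : k ≤ n) (z : ℕ → EuclideanSpace ℝ (Fin d)) :
    psi n k z = (n : ℝ)⁻¹ • ∑ i ∈ Finset.range n, phaseWeight n k i • z i := by
  rw [sum_phases hkn (fun c i => c • z i), smul_add, psi, ← Finset.smul_sum, ← Finset.smul_sum,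
    smul_smul, smul_smul, mul_inv, mul_inv, mul_neg, neg_smul, sub_eq_add_neg]

theorem z_response_self {d : ℕ} (k : ℕ) (X : ℕ → EuclideanSpace ℝ (Fin d))
    (β : EuclideanSpace ℝ (Fin d)) (e : ℕ → ℝ) : z X (response k X β β e) β = z0 X e := by
  ext1 i
  simp [z, response, z0]

variable {Ω : Type*} [MeasurableSpace Ω] {P : Measure Ω} [IsProbabilityMeasure P]

theorem varMatrix_z0 {d : ℕ} (X : ℕ → EuclideanSpace ℝ (Fin d)) {ε : ℕ → Ω → ℝ} {τ : ℝ}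
    (hL : ∀ i, MemLp (ε i) 2 P) (h0 : ∀ i, ∫ ω, ε i ω ∂P = 0)
    (hτ : ∀ i, ∫ ω, ε i ω ^ 2 ∂P = τ) (i : ℕ) (s t : Fin d) :
    varMatrix P (fun ω => z0 X (fun m => ε m ω) i) s t = τ * (X i s * X i t) := by
  have h1 : cov[ε i, ε i; P] = τ := by
    rw [covariance_eq_sub (hL i) (hL i), h0 i, ← hτ i]
    simp [sq]
  simp only [varMatrix, z0, Matrix.of_apply, PiLp.smul_apply, smul_eq_mul]
  rw [covariance_mul_const_left, covariance_mul_const_right, h1]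
  ring

/-- Squaring the weight removes its sign and produces θ⁻² and (1-θ)⁻², so both phases merge into a
single average of τ a_i a_iᵗ. -/
theorem V0_apply {d n k : ℕ} (hkn : k ≤ n) (X : ℕ → EuclideanSpace ℝ (Fin d))
    {ε : ℕ → Ω → ℝ} {τ : ℝ}
    (hL : ∀ i, MemLp (ε i) 2 P) (h0 : ∀ i, ∫ ω, ε i ω ∂P = 0)
    (hτ : ∀ i, ∫ ω, ε i ω ^ 2 ∂P = τ) (s t : Fin d) :
    V0 P n k X ε s t = (n : ℝ)⁻¹ * ∑ i ∈ Finset.range n,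
      τ * ((phaseWeight n k i • X i) s * (phaseWeight n k i • X i) t) := by
  rw [sum_phases hkn (fun c i => τ * ((c • X i) s * (c • X i) t))]
  simp only [V0, Matrix.add_apply, Matrix.smul_apply, Matrix.sum_apply, varMatrix_z0 X hL h0 hτ,
    PiLp.smul_apply, smul_eq_mul, mul_add, Finset.mul_sum]
  congr 1 <;> refine Finset.sum_congr rfl fun i _ => ?_ <;> rw [mul_inv, ← inv_pow] <;> ring

theorem toEuclideanLin_V0_apply {d n k : ℕ} (hkn : k ≤ n) (X : ℕ → EuclideanSpace ℝ (Fin d))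
    {ε : ℕ → Ω → ℝ} {τ : ℝ}
    (hL : ∀ i, MemLp (ε i) 2 P) (h0 : ∀ i, ∫ ω, ε i ω ∂P = 0)
    (hτ : ∀ i, ∫ ω, ε i ω ^ 2 ∂P = τ) (x : EuclideanSpace ℝ (Fin d)) :
    Matrix.toEuclideanLin (V0 P n k X ε) x = (n : ℝ)⁻¹ • ∑ i ∈ Finset.range n,
      (τ * inner ℝ x (phaseWeight n k i • X i)) • phaseWeight n k i • X i := by
  ext s
  rw [Matrix.toLpLin_apply]
  simp only [Matrix.mulVec, dotProduct, V0_apply hkn X hL h0 hτ]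
  rw [PiLp.smul_apply, WithLp.ofLp_sum, Finset.sum_apply, smul_eq_mul, Finset.mul_sum]
  simp only [Finset.mul_sum, Finset.sum_mul]
  rw [Finset.sum_comm]
  refine Finset.sum_congr rfl fun i _ => ?_
  generalize phaseWeight n k i • X i = a
  rw [PiLp.smul_apply, smul_eq_mul, PiLp.inner_apply, Finset.mul_sum, Finset.sum_mul,
    Finset.mul_sum]
  refine Finset.sum_congr rfl fun t _ => ?_
  simp only [RCLike.inner_apply, conj_trivial]
  ring

theorem isSymmetric_V0 {d n k : ℕ} (hkn : k ≤ n) (X : ℕ → EuclideanSpace ℝ (Fin d))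
    {ε : ℕ → Ω → ℝ} {τ : ℝ}
    (hL : ∀ i, MemLp (ε i) 2 P) (h0 : ∀ i, ∫ ω, ε i ω ∂P = 0)
    (hτ : ∀ i, ∫ ω, ε i ω ^ 2 ∂P = τ) :
    (Matrix.toEuclideanLin (V0 P n k X ε)).IsSymmetric := by
  intro x y
  rw [toEuclideanLin_V0_apply hkn X hL h0 hτ, toEuclideanLin_V0_apply hkn X hL h0 hτ,
    real_inner_smul_left, inner_smul_right, sum_inner, inner_sum]
  congr 1
  refine Finset.sum_congr rfl fun i _ => ?_
  generalize phaseWeight n k i • X i = a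
  rw [real_inner_smul_left, real_inner_smul_right, real_inner_comm y]
  ring

theorem _root_.Matrix.hasEigenvalue_toLin'_of_toEuclideanLin {d : ℕ}
    {A : Matrix (Fin d) (Fin d) ℝ} {μ : ℝ}
    (h : Module.End.HasEigenvalue (Matrix.toEuclideanLin A) μ) :
    Module.End.HasEigenvalue (Matrix.toLin' A) μ := by
  obtain ⟨v, hv⟩ := h.exists_hasEigenvector
  refine Module.End.hasEigenvalue_of_hasEigenvector (x := v.ofLp)
    (Module.End.hasEigenvector_iff.mpr ⟨Module.End.mem_eigenspace_iff.mpr ?_, ?_⟩)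
  · have := congrArg WithLp.ofLp hv.apply_eq_smul
    rwa [Matrix.ofLp_toLpLin] at this
  · exact fun h0 => hv.2 (by ext s; simp [h0])

end Model

/-! ### Frobenius control of matrix errors, and size of the design -/

section Frobenius

variable {d : ℕ}

/-- The rank-one matrix `a aᵗ` as a vector of coordinates. -/
noncomputable def outerSq (a : EuclideanSpace ℝ (Fin d)) : EuclideanSpace ℝ (Fin d × Fin d) :=
  WithLp.toLp 2 fun st => a st.1 * a st.2

theorem norm_outerSq (a : EuclideanSpace ℝ (Fin d)) : ‖outerSq a‖ = ‖a‖ ^ 2 := by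
  rw [← sq_eq_sq₀ (norm_nonneg _) (by positivity), EuclideanSpace.real_norm_sq_eq,
    EuclideanSpace.real_norm_sq_eq, sq, Finset.sum_mul_sum, Fintype.sum_prod_type]
  simp only [outerSq, mul_pow]

/-- Operator norm is at most Frobenius norm: Cauchy–Schwarz on each row. -/
theorem norm_sum_smul_inner_smul_le (s : Finset ℕ) (ζ : ℕ → ℝ)
    (a : ℕ → EuclideanSpace ℝ (Fin d)) (x : EuclideanSpace ℝ (Fin d)) :
    ‖∑ i ∈ s, (ζ i * inner ℝ x (a i)) • a i‖ ≤ ‖∑ i ∈ s, ζ i • outerSq (a i)‖ * ‖x‖ := by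
  set D := ∑ i ∈ s, ζ i • outerSq (a i) with hD
  refine abs_le_of_sq_le_sq' ?_ (by positivity) |>.2
  rw [mul_pow, EuclideanSpace.real_norm_sq_eq, EuclideanSpace.real_norm_sq_eq D,
    EuclideanSpace.real_norm_sq_eq x, Fintype.sum_prod_type, Finset.sum_mul]
  refine Finset.sum_le_sum fun u _ => ?_
  have h : (∑ i ∈ s, (ζ i * inner ℝ x (a i)) • a i) u = ∑ t, D (u, t) * x t := by
    simp only [hD, WithLp.ofLp_sum, Finset.sum_apply, PiLp.smul_apply, smul_eq_mul, outerSq,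
      Finset.sum_mul]
    rw [Finset.sum_comm]
    refine Finset.sum_congr rfl fun i _ => ?_
    rw [PiLp.inner_apply, Finset.mul_sum, Finset.sum_mul]
    refine Finset.sum_congr rfl fun t _ => ?_
    simp only [RCLike.inner_apply, conj_trivial]
    ring
  rw [h]
  exact Finset.sum_mul_sq_le_sq_mul_sq _ _ _

/-- Coordinatewise, x² ≤ 1 + |x|^q for q ≥ 2. -/
theorem norm_sq_le_of_moment {x : EuclideanSpace ℝ (Fin d)} {q C : ℝ} (hd : 0 < d) (hq : 2 ≤ q)
    (h : (d : ℝ)⁻¹ * ∑ s, |x s| ^ q < C) : ‖x‖ ^ 2 ≤ (1 + |C|) * d := by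
  have hd' : (0 : ℝ) < d := by exact_mod_cast hd
  rw [inv_mul_lt_iff₀ hd'] at h
  rw [EuclideanSpace.real_norm_sq_eq]
  calc ∑ s, x s ^ 2 ≤ ∑ s, (1 + |x s| ^ q) := by
        refine Finset.sum_le_sum fun s _ => ?_
        rw [← sq_abs]
        rcases le_total |x s| 1 with h1 | h1
        · have : 0 ≤ |x s| ^ q := by positivity
          have : |x s| ^ 2 ≤ 1 := pow_le_one₀ (abs_nonneg _) h1
          linarith
        · have := Real.rpow_le_rpow_of_exponent_le h1 hq
          rw [Real.rpow_two] at this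
          linarith
    _ = d + ∑ s, |x s| ^ q := by simp [Finset.sum_add_distrib]
    _ ≤ (1 + |C|) * d := by nlinarith [le_abs_self C]

end Frobenius

/-! ### Existence and expansion on the good event -/

section Expansion

variable {Ω : Type*} [MeasurableSpace Ω] {P : Measure Ω} [IsProbabilityMeasure P]

/-- Constant in the relative error of the first-order expansion of the multiplier. -/
noncomputable def expansionConst (C₀ C₁ : ℝ) : ℝ :=
  (4 / C₀ + 32 * (C₁ + 1) / C₀ ^ 2) * C₁ / C₀

theorem expansionConst_nonneg {C₀ C₁ : ℝ} (hC₀ : 0 < C₀) (hC₁ : 0 ≤ C₁) :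
    0 ≤ expansionConst C₀ C₁ := by
  rw [expansionConst]; positivity

/-- The lower bound makes V injective, so `V⁻¹` is a genuine inverse rather than the default value
0. -/
theorem toEuclideanLin_inv_mulVec {d : ℕ} {V : Matrix (Fin d) (Fin d) ℝ} {c : ℝ} (hc : 0 < c)
    (hV : ∀ x, c * ‖x‖ ≤ ‖Matrix.toEuclideanLin V x‖) (y : EuclideanSpace ℝ (Fin d)) :
    Matrix.toEuclideanLin V (WithLp.toLp 2 (V⁻¹.mulVec y.ofLp)) = y := by
  have hinj : Function.Injective V.mulVec := by
    intro x x' h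
    have h1 := hV (WithLp.toLp 2 x - WithLp.toLp 2 x')
    rw [map_sub, Matrix.toLpLin_apply, Matrix.toLpLin_apply] at h1
    simp only at h1
    rw [h, sub_self, norm_zero] at h1
    have h2 : ‖WithLp.toLp 2 x - WithLp.toLp 2 x'‖ = 0 :=
      le_antisymm (nonpos_of_mul_nonpos_right h1 hc) (norm_nonneg _)
    exact WithLp.toLp_injective 2 (sub_eq_zero.mp (norm_eq_zero.mp h2))
  have hu : IsUnit V.det :=
    (Matrix.isUnit_iff_isUnit_det V).mp (Matrix.mulVec_injective_iff_isUnit.mp hinj)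
  rw [Matrix.toLpLin_apply]
  simp only [Matrix.mulVec_mulVec, Matrix.mul_nonsing_inv V hu, Matrix.one_mulVec]

theorem exists_isMultiplier_and_expansion {d n k : ℕ} (hk : 0 < k) (hkn : k < n)
    (X : ℕ → EuclideanSpace ℝ (Fin d)) {ε : ℕ → Ω → ℝ} {τ B C₀ C₁ η m : ℝ}
    (hL : ∀ i, MemLp (ε i) 2 P) (h0 : ∀ i, ∫ ω, ε i ω ∂P = 0)
    (hτ : ∀ i, ∫ ω, ε i ω ^ 2 ∂P = τ) (hC₀ : 0 < C₀)
    (hV : ∀ μ : ℝ, Module.End.HasEigenvalue (Matrix.toLin' (V0 P n k X ε)) μ → C₀ < μ ∧ μ < C₁)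
    (hm : 0 ≤ m) (hη : η ≤ C₀ / 50) (hη1 : η ≤ 1)
    (hB : ∀ i < n, ‖phaseWeight n k i • X i‖ ^ 2 ≤ B) {e : ℕ → ℝ} (he : ∀ i < n, |e i| ≤ m)
    (hψ : √B * m * ‖∑ i ∈ Finset.range n, e i • (n : ℝ)⁻¹ • phaseWeight n k i • X i‖ ≤ η)
    (hD : ‖∑ i ∈ Finset.range n,
      (e i ^ 2 - τ) • (n : ℝ)⁻¹ • outerSq (phaseWeight n k i • X i)‖ ≤ η) :
    (∃ l, IsMultiplier n k (z0 X e) l) ∧ ∀ l, IsMultiplier n k (z0 X e) l →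
      ‖l - WithLp.toLp 2 ((V0 P n k X ε)⁻¹.mulVec (psi n k (z0 X e)).ofLp)‖ ≤
        expansionConst C₀ (max C₁ 0) * η *
          ‖WithLp.toLp 2 ((V0 P n k X ε)⁻¹.mulVec (psi n k (z0 X e)).ofLp)‖ := by
  have hn : (0 : ℝ) < n := by exact_mod_cast hk.trans hkn
  set T := Matrix.toEuclideanLin (V0 P n k X ε) with hT
  set ψ := psi n k (z0 X e) with hψdef
  set w : ℕ → EuclideanSpace ℝ (Fin d) := fun i => phaseWeight n k i • z0 X e i with hw
  have hwa : ∀ i, w i = e i • phaseWeight n k i • X i := fun i => by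
    rw [hw, smul_comm]; rfl
  have hsym : T.IsSymmetric := isSymmetric_V0 hkn.le X hL h0 hτ
  have hT₀ : ∀ x, C₀ * ‖x‖ ^ 2 ≤ inner ℝ x (T x) := hsym.le_inner_of_eigenvalues
    fun μ hμ => (hV μ (Matrix.hasEigenvalue_toLin'_of_toEuclideanLin hμ)).1.le
  have hT₁ : ∀ x, ‖T x‖ ≤ max C₁ 0 * ‖x‖ := by
    refine hsym.norm_apply_le_of_eigenvalues (le_max_right _ _) fun μ hμ => ?_
    have h := hV μ (Matrix.hasEigenvalue_toLin'_of_toEuclideanLin hμ)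
    rw [abs_of_pos (hC₀.trans h.1)]
    exact h.2.le.trans (le_max_left _ _)
  have hT₀' : ∀ x, C₀ * ‖x‖ ≤ ‖T x‖ := by
    intro x
    rcases eq_or_ne x 0 with rfl | hx
    · simp
    · refine le_of_mul_le_mul_left ?_ (norm_pos_iff.mpr hx)
      have := (hT₀ x).trans (real_inner_le_norm x (T x))
      linarith
  have hu : T (WithLp.toLp 2 ((V0 P n k X ε)⁻¹.mulVec ψ.ofLp)) = ψ :=
    toEuclideanLin_inv_mulVec hC₀ hT₀' ψ
  have hsum : ∑ i ∈ Finset.range n, w i = (n : ℝ) • ψ := by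
    rw [hψdef, psi_eq_sum hkn.le, smul_inv_smul₀ hn.ne']
  have hψsum : ψ = ∑ i ∈ Finset.range n, e i • (n : ℝ)⁻¹ • phaseWeight n k i • X i := by
    rw [hψdef, psi_eq_sum hkn.le, Finset.smul_sum]
    refine Finset.sum_congr rfl fun i _ => ?_
    rw [smul_comm (e i), ← hwa i]
  rw [← hψsum] at hψ
  have hM : ∀ i ∈ Finset.range n, ‖w i‖ ≤ √B * m := by
    intro i hi
    rw [hwa, norm_smul, mul_comm, Real.norm_eq_abs]
    exact mul_le_mul (Real.le_sqrt_of_sq_le (hB i (Finset.mem_range.mp hi)))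
      (he i (Finset.mem_range.mp hi)) (abs_nonneg _) (Real.sqrt_nonneg _)
  have hM0 : 0 ≤ √B * m := by positivity
  have hST : ∀ x, ‖(n : ℝ)⁻¹ • (∑ i ∈ Finset.range n, inner ℝ x (w i) • w i) - T x‖ ≤
      η * ‖x‖ := by
    intro x
    have h1 : (n : ℝ)⁻¹ • (∑ i ∈ Finset.range n, inner ℝ x (w i) • w i) - T x =
        ∑ i ∈ Finset.range n, (((e i ^ 2 - τ) * (n : ℝ)⁻¹) *
          inner ℝ x (phaseWeight n k i • X i)) • phaseWeight n k i • X i := by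
      rw [hT, toEuclideanLin_V0_apply hkn.le X hL h0 hτ, ← smul_sub, ← Finset.sum_sub_distrib,
        Finset.smul_sum]
      refine Finset.sum_congr rfl fun i _ => ?_
      rw [hwa]
      generalize phaseWeight n k i • X i = a
      rw [real_inner_smul_right, smul_smul, ← sub_smul, smul_smul]
      congr 1
      ring
    rw [h1]
    refine (norm_sum_smul_inner_smul_le _ _ _ x).trans ?_
    gcongr
    simpa only [smul_smul] using hD
  have hS := quadratic_form_lower_bound hn (by linarith) hST hT₀
  refine ⟨?_, fun l hl => ?_⟩
  · obtain ⟨l, hl⟩ := exists_isTilt hn (half_pos hC₀) hsum hM (by linarith) hS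
    exact ⟨l, (isMultiplier_iff_isTilt hk hkn _ l).mpr hl⟩
  · exact ((isMultiplier_iff_isTilt hk hkn _ l).mp hl).norm_sub_le hn hC₀ (le_max_right _ _) hM0
      hη hη1 hsum hM hψ hS hST hT₀' hT₁ hu

end Expansion

/-! ### Consequences of the error moments -/

section Moments

variable {Ω : Type*} [MeasurableSpace Ω] {P : Measure Ω}

theorem integrable_pow_four_of_lintegral [IsFiniteMeasure P] {f : Ω → ℝ} (hf : Measurable f)
    {r : ℝ} (hr : 4 ≤ r) (h : ∫⁻ ω, ENNReal.ofReal (|f ω| ^ r) ∂P < ⊤) :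
    Integrable (fun ω => f ω ^ 4) P := by
  have h1 : Integrable (fun ω => |f ω| ^ r) P := by
    refine ⟨(by fun_prop : Measurable fun ω => |f ω| ^ r).aestronglyMeasurable, ?_⟩
    rwa [hasFiniteIntegral_iff_ofReal (Eventually.of_forall fun ω => by positivity)]
  refine ((integrable_const (1 : ℝ)).add h1).mono'
    (hf.pow_const 4).aestronglyMeasurable (Eventually.of_forall fun ω => ?_)
  have hp : 0 ≤ |f ω| ^ r := by positivity
  rw [norm_pow, Real.norm_eq_abs, Pi.add_apply]
  rcases le_total |f ω| 1 with h2 | h2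
  · have : |f ω| ^ 4 ≤ 1 := pow_le_one₀ (abs_nonneg _) h2
    linarith
  · have := Real.rpow_le_rpow_of_exponent_le h2 hr
    norm_cast at this
    linarith

/-- Markov at exponent 2q bounds each tail by C/n²; the union over n indices costs a factor n. -/
theorem measure_exists_lt_abs_le {ε : ℕ → Ω → ℝ} (hε : ∀ i, IdentDistrib (ε i) (ε 0) P P)
    {q C : ℝ} (hq : 0 < q)
    (h : ∫⁻ ω, ENNReal.ofReal (|ε 0 ω| ^ (2 * q)) ∂P < ENNReal.ofReal C) {n : ℕ} (hn : 0 < n) :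
    P {ω | ∃ i < n, (n : ℝ) ^ (1 / q) < |ε i ω|} ≤ ENNReal.ofReal (C / n) := by
  have hn' : (0 : ℝ) < n := by exact_mod_cast hn
  have hmeas : Measurable fun x : ℝ => ENNReal.ofReal (|x| ^ (2 * q)) := by fun_prop
  have hone : ∀ i, P {ω | (n : ℝ) ^ (1 / q) < |ε i ω|} ≤ ENNReal.ofReal (C / n ^ 2) := by
    intro i
    have hsub : {ω | (n : ℝ) ^ (1 / q) < |ε i ω|} ⊆
        {ω | ENNReal.ofReal ((n : ℝ) ^ 2) ≤ ENNReal.ofReal (|ε i ω| ^ (2 * q))} := by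
      intro ω (hω : (n : ℝ) ^ (1 / q) < |ε i ω|)
      refine ENNReal.ofReal_le_ofReal ?_
      have h1 := Real.rpow_le_rpow (by positivity) hω.le (by positivity : 0 ≤ 2 * q)
      rw [← Real.rpow_mul hn'.le, show 1 / q * (2 * q) = 2 by field_simp, Real.rpow_two] at h1
      exact h1
    have hlint : ∫⁻ ω, ENNReal.ofReal (|ε i ω| ^ (2 * q)) ∂P =
        ∫⁻ ω, ENNReal.ofReal (|ε 0 ω| ^ (2 * q)) ∂P := ((hε i).comp hmeas).lintegral_eq
    refine (measure_mono hsub).trans ((meas_ge_le_lintegral_div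
      (hmeas.comp_aemeasurable (hε i).aemeasurable_fst)
      (ENNReal.ofReal_pos.mpr (by positivity)).ne'
      ENNReal.ofReal_ne_top).trans ?_)
    rw [ENNReal.ofReal_div_of_pos (by positivity)]
    gcongr
    exact hlint.trans_le h.le
  calc P {ω | ∃ i < n, (n : ℝ) ^ (1 / q) < |ε i ω|}
      = P (⋃ i ∈ Finset.range n, {ω | (n : ℝ) ^ (1 / q) < |ε i ω|}) := by
        congr 1
        ext ω
        simp
    _ ≤ ∑ i ∈ Finset.range n, P {ω | (n : ℝ) ^ (1 / q) < |ε i ω|} := measure_biUnion_finset_le _ _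
    _ ≤ ∑ i ∈ Finset.range n, ENNReal.ofReal (C / n ^ 2) := Finset.sum_le_sum fun i _ => hone i
    _ = ENNReal.ofReal (C / n) := by
        rw [Finset.sum_const, Finset.card_range, nsmul_eq_mul, ← ENNReal.ofReal_natCast,
          ← ENNReal.ofReal_mul hn'.le]
        congr 1
        field_simp

end Moments

/-! ### Probability of the bad event and asymptotics -/

section Probability

variable {Ω : Type*} [MeasurableSpace Ω] {P : Measure Ω} [IsProbabilityMeasure P]

/-- Failure forces a large error, a large `ψ`, or a large Frobenius deviation. Only monotonicity and
subadditivity of P are applied to the failure event, so its measurability is immaterial. -/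
theorem measure_expansion_fails_le {d n k : ℕ} (hd : 0 < d) (hk : 0 < k) (hkn : k < n)
    (X : ℕ → EuclideanSpace ℝ (Fin d)) {ε : ℕ → Ω → ℝ} {τ κ b C₀ C₁ C₄ η q : ℝ} (hq : 2 ≤ q)
    (hident : ∀ i, IdentDistrib (ε i) (ε 0) P P)
    (hind : Pairwise fun i j => IndepFun (ε i) (ε j) P)
    (hL : ∀ i, MemLp (ε i) 2 P) (h0 : ∀ i, ∫ ω, ε i ω ∂P = 0)
    (hτ : ∀ i, ∫ ω, ε i ω ^ 2 ∂P = τ)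
    (hL' : ∀ i, MemLp (fun ω => ε i ω ^ 2 - τ) 2 P)
    (hκ : ∀ i, ∫ ω, (ε i ω ^ 2 - τ) ^ 2 ∂P = κ)
    (hmom : ∫⁻ ω, ENNReal.ofReal (|ε 0 ω| ^ (2 * q)) ∂P < ENNReal.ofReal C₄) (hC₀ : 0 < C₀)
    (hV : ∀ μ : ℝ, Module.End.HasEigenvalue (Matrix.toLin' (V0 P n k X ε)) μ → C₀ < μ ∧ μ < C₁)
    (hη0 : 0 < η) (hη : η ≤ C₀ / 50) (hη1 : η ≤ 1) (hb : 0 < b)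
    (hB : ∀ i < n, ‖phaseWeight n k i • X i‖ ^ 2 ≤ b * d) :
    P {ω | ¬ ((∃ l, IsMultiplier n k (z0 X fun i => ε i ω) l) ∧
      ∀ l, IsMultiplier n k (z0 X fun i => ε i ω) l →
      ‖l - WithLp.toLp 2 ((V0 P n k X ε)⁻¹.mulVec (psi n k (z0 X fun i => ε i ω)).ofLp)‖ ≤
        expansionConst C₀ (max C₁ 0) * η *
          ‖WithLp.toLp 2 ((V0 P n k X ε)⁻¹.mulVec (psi n k (z0 X fun i => ε i ω)).ofLp)‖)} ≤
      ENNReal.ofReal (C₄ / n + (τ + κ) * b ^ 2 / η ^ 2 *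
        ((d : ℝ) * (n : ℝ) ^ ((2 - q) / (2 * q))) ^ 2) := by
  have hn' : 0 < n := hk.trans hkn
  have hn : (0 : ℝ) < n := by exact_mod_cast hn'
  have hn1 : (1 : ℝ) ≤ n := by exact_mod_cast hn'
  have hd' : (0 : ℝ) < d := by exact_mod_cast hd
  set m : ℝ := (n : ℝ) ^ (1 / q) with hm
  have hm0 : 0 < m := by positivity
  have hm1 : 1 ≤ m := Real.one_le_rpow hn1 (by positivity)
  set M : ℝ := √(b * d) * m with hM
  have hM0 : 0 < M := by positivity
  -- The exponent (2-q)/(2q) is 1/q - 1/2.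
  have hr : ((d : ℝ) * (n : ℝ) ^ ((2 - q) / (2 * q))) ^ 2 = d ^ 2 * m ^ 2 / n := by
    have h1 : ((n : ℝ) ^ ((2 - q) / (2 * q))) ^ 2 = m ^ 2 / n := by
      rw [hm, ← Real.rpow_natCast, ← Real.rpow_natCast, ← Real.rpow_mul hn.le,
        ← Real.rpow_mul hn.le]
      nth_rewrite 3 [← Real.rpow_one (n : ℝ)]
      rw [← Real.rpow_sub hn]
      congr 1
      push_cast
      field_simp
    rw [mul_pow, h1, mul_div_assoc]
  have hτ0 : 0 ≤ τ := by rw [← hτ 0]; positivity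
  have hκ0 : 0 ≤ κ := by rw [← hκ 0]; positivity
  have hC₄ : 0 < C₄ := ENNReal.ofReal_pos.mp (bot_le.trans_lt hmom)
  have h0' : ∀ i, ∫ ω, (ε i ω ^ 2 - τ) ∂P = 0 := fun i => by
    rw [integral_sub (hL i).integrable_sq (integrable_const τ), hτ i]
    simp
  have hsqm : Measurable fun x : ℝ => x ^ 2 - τ := by fun_prop
  have hind' : Pairwise fun i j =>
      IndepFun (fun ω => ε i ω ^ 2 - τ) (fun ω => ε j ω ^ 2 - τ) P :=
    fun i j hij => (hind hij).comp hsqm hsqm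
  have hmax := measure_exists_lt_abs_le hident (by linarith : 0 < q) hmom hn'
  have hpsi := measure_lt_norm_sum_smul_le hL h0 hτ hind (Finset.range n)
    (fun i => (n : ℝ)⁻¹ • phaseWeight n k i • X i) (div_pos hη0 hM0)
  have hfro := measure_lt_norm_sum_smul_le hL' h0' hκ hind' (Finset.range n)
    (fun i => (n : ℝ)⁻¹ • outerSq (phaseWeight n k i • X i)) hη0
  have hs1 : ∑ i ∈ Finset.range n, ‖(n : ℝ)⁻¹ • phaseWeight n k i • X i‖ ^ 2 ≤ b * d / n := by
    calc _ ≤ ∑ i ∈ Finset.range n, (n : ℝ)⁻¹ ^ 2 * (b * d) := by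
          refine Finset.sum_le_sum fun i hi => ?_
          rw [norm_smul, mul_pow, Real.norm_of_nonneg (by positivity)]
          gcongr
          exact hB i (Finset.mem_range.mp hi)
      _ = b * d / n := by
          rw [Finset.sum_const, Finset.card_range, nsmul_eq_mul]
          field_simp
  have hs2 : ∑ i ∈ Finset.range n, ‖(n : ℝ)⁻¹ • outerSq (phaseWeight n k i • X i)‖ ^ 2 ≤
      (b * d) ^ 2 / n := by
    calc _ ≤ ∑ i ∈ Finset.range n, (n : ℝ)⁻¹ ^ 2 * (b * d) ^ 2 := by
          refine Finset.sum_le_sum fun i hi => ?_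
          rw [norm_smul, mul_pow, Real.norm_of_nonneg (by positivity), norm_outerSq]
          gcongr
          exact hB i (Finset.mem_range.mp hi)
      _ = (b * d) ^ 2 / n := by
          rw [Finset.sum_const, Finset.card_range, nsmul_eq_mul]
          field_simp
  have hpsi' := hpsi.trans (ENNReal.ofReal_le_ofReal
    (q := τ * b ^ 2 / η ^ 2 * (d ^ 2 * m ^ 2 / n)) (by
      calc _ ≤ τ * (b * d / n) / (η / M) ^ 2 := by gcongr
        _ = τ * (b * d / n) * (√(b * d) ^ 2 * m ^ 2) / η ^ 2 := by
          rw [hM]; field_simp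
        _ = _ := by
          rw [Real.sq_sqrt (by positivity)]; field_simp))
  -- This term is of order d²/n; the factor m² ≥ 1 is inserted only to share the rate of the `ψ`
  -- term.
  have hfro' := hfro.trans (ENNReal.ofReal_le_ofReal
    (q := κ * b ^ 2 / η ^ 2 * (d ^ 2 * m ^ 2 / n)) (by
      calc _ ≤ κ * ((b * d) ^ 2 / n) / η ^ 2 := by gcongr
        _ = κ * b ^ 2 / η ^ 2 * (d ^ 2 * 1 ^ 2 / n) := by field_simp
        _ ≤ _ := by gcongr))
  rw [hr]
  calc _ ≤ P ({ω | ∃ i < n, m < |ε i ω|} ∪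
        ({ω | η / M < ‖∑ i ∈ Finset.range n, ε i ω • (n : ℝ)⁻¹ • phaseWeight n k i • X i‖} ∪
        {ω | η < ‖∑ i ∈ Finset.range n,
          (ε i ω ^ 2 - τ) • (n : ℝ)⁻¹ • outerSq (phaseWeight n k i • X i)‖})) := by
        refine measure_mono fun ω hω => ?_
        by_contra hcon
        simp only [Set.mem_union, Set.mem_ofPred_eq, not_or, not_exists, not_and, not_lt] at hcon
        refine hω (exists_isMultiplier_and_expansion hk hkn X hL h0 hτ hC₀ hV hm0.le hη hη1 hB
          hcon.1 ?_ hcon.2.2)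
        have := hcon.2.1
        rwa [le_div_iff₀ hM0, mul_comm] at this
    _ ≤ ENNReal.ofReal (C₄ / n) + (ENNReal.ofReal (τ * b ^ 2 / η ^ 2 * (d ^ 2 * m ^ 2 / n)) +
          ENNReal.ofReal (κ * b ^ 2 / η ^ 2 * (d ^ 2 * m ^ 2 / n))) :=
        (measure_union_le _ _).trans (add_le_add hmax
          ((measure_union_le _ _).trans (add_le_add hpsi' hfro')))
    _ = _ := by
        rw [← ENNReal.ofReal_add (by positivity) (by positivity),
          ← ENNReal.ofReal_add (by positivity) (by positivity)]
        congr 1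
        ring

theorem eventually_abs_phaseWeight_le {k : ℕ → ℕ} {θ₀ : ℝ} (hθ₀ : θ₀ ∈ Set.Ioo (0 : ℝ) 1)
    (hk : Tendsto (fun n => (k n : ℝ) / (n : ℝ)) atTop (𝓝 θ₀)) :
    ∀ᶠ n in atTop, 0 < k n ∧ k n < n ∧
      ∀ i, |phaseWeight n (k n) i| ≤ 2 / θ₀ + 2 / (1 - θ₀) := by
  have h0 := hθ₀.1
  have h1 : 0 < 1 - θ₀ := sub_pos.mpr hθ₀.2
  filter_upwards [hk.eventually_const_lt (show θ₀ / 2 < θ₀ by linarith),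
    hk.eventually_lt_const (show θ₀ < (1 + θ₀) / 2 by linarith [hθ₀.2]),
    eventually_gt_atTop 0] with n hl hu hn
  have hn' : (0 : ℝ) < n := by exact_mod_cast hn
  refine ⟨?_, ?_, fun i => ?_⟩
  · have : (0 : ℝ) < k n := by
      by_contra! h
      have := div_nonpos_of_nonpos_of_nonneg h hn'.le
      linarith
    exact_mod_cast this
  · have : (k n : ℝ) / n < 1 := by linarith [hθ₀.2]
    rw [div_lt_one hn'] at this
    exact_mod_cast this
  · rw [phaseWeight]
    split_ifs
    · rw [abs_inv, abs_of_pos (by linarith)]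
      have : ((k n : ℝ) / n)⁻¹ ≤ (θ₀ / 2)⁻¹ := by gcongr
      rw [inv_div θ₀] at this
      have : 0 < 2 / (1 - θ₀) := by positivity
      linarith
    · rw [abs_neg, abs_inv, abs_of_pos (by linarith)]
      have : (1 - (k n : ℝ) / n)⁻¹ ≤ ((1 - θ₀) / 2)⁻¹ := by gcongr; linarith
      rw [inv_div (1 - θ₀)] at this
      have : 0 < 2 / θ₀ := by positivity
      linarith

/-- Since s ≤ 0 and k ≤ n, n^s ≤ k^s: the growth condition on the first phase already gives the one
in n. -/
theorem tendsto_dim_mul_rpow {p k : ℕ → ℕ} {s : ℝ} (hs : s ≤ 0)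
    (hk : ∀ᶠ n in atTop, 0 < k n ∧ k n ≤ n)
    (h : Tendsto (fun n => (p n : ℝ) * (k n : ℝ) ^ s) atTop (𝓝 0)) :
    Tendsto (fun n => (p n : ℝ) * (n : ℝ) ^ s) atTop (𝓝 0) := by
  refine tendsto_of_tendsto_of_tendsto_of_le_of_le' tendsto_const_nhds h
    (Eventually.of_forall fun n => by positivity) ?_
  filter_upwards [hk] with n hn
  gcongr ?_ * ?_
  exact Real.rpow_le_rpow_of_nonpos (by exact_mod_cast hn.1) (by exact_mod_cast hn.2) hs

end Probability

end TwoSampleEL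

/-! ### The main theorem -/

theorem proposition2
    {Ω : Type*} [MeasurableSpace Ω] (P : Measure Ω) [IsProbabilityMeasure P]
    -- dimension, change-point, design, coefficients on the two phases, errors
    (p k : ℕ → ℕ)
    (X : (n : ℕ) → ℕ → EuclideanSpace ℝ (Fin (p n)))
    (β β₂ : (n : ℕ) → EuclideanSpace ℝ (Fin (p n)))
    (ε : ℕ → Ω → ℝ)
    -- the errors are i.i.d. with mean zero and finite variance
    (hεm : ∀ i, Measurable (ε i))
    (hεindep : iIndepFun ε P)
    (hεident : ∀ i, IdentDistrib (ε i) (ε 0) P P)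
    (hεvar : MemLp (ε 0) 2 P)
    (hεmean : ∫ ω, ε 0 ω ∂P = 0)
    -- growing dimension, and location of the change-point
    (hp : Tendsto p atTop atTop)
    (θ₀ : ℝ) (hθ₀ : θ₀ ∈ Set.Ioo (0 : ℝ) 1)
    (hk : Tendsto (fun n => (k n : ℝ) / (n : ℝ)) atTop (𝓝 θ₀))
    -- null hypothesis: no change
    (H0 : ∀ n, β₂ n = β n)
    -- the eigenvalues of `V_n⁰` are bounded away from zero and infinity
    (C₀ C₁ : ℝ) (hC₀ : 0 < C₀)
    (hA1 : ∀ᶠ n in atTop, ∀ μ : ℝ,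
      Module.End.HasEigenvalue (Matrix.toLin' (TwoSampleEL.V0 P n (k n) (X n) ε)) μ →
        C₀ < μ ∧ μ < C₁)
    (q : ℝ) (hq : 4 ≤ q)
    -- moment bound on the design
    (C₃ : ℝ)
    (hA3 : ∀ n, ∀ i < n, (p n : ℝ)⁻¹ * ∑ s, |X n i s| ^ q < C₃)
    -- moment bound on the errors
    (C₄ : ℝ)
    (hA4 : ∫⁻ ω, ENNReal.ofReal (|ε 0 ω| ^ (2 * q)) ∂P < ENNReal.ofReal C₄)
    -- first growth condition on the dimension, on both phases
    (hA5 : Tendsto (fun n => (p n : ℝ) * (k n : ℝ) ^ ((2 - q) / (2 * q))) atTop (𝓝 0))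
    (hA5' : Tendsto (fun n => (p n : ℝ) * ((n : ℝ) - (k n : ℝ)) ^ ((2 - q) / (2 * q)))
      atTop (𝓝 0))
    -- second growth condition on the dimension, on both phases
    (hA6 : Tendsto (fun n => (p n : ℝ) ^ (2 + 4 / q) * (k n : ℝ)⁻¹) atTop (𝓝 0))
    (hA6' : Tendsto (fun n => (p n : ℝ) ^ (2 + 4 / q) * ((n : ℝ) - (k n : ℝ))⁻¹) atTop (𝓝 0))
    -- the vectors `z_i(β⁰)` computed from the observed responses
    (Z : (n : ℕ) → Ω → ℕ → EuclideanSpace ℝ (Fin (p n)))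
    (hZ : Z = fun n ω => TwoSampleEL.z (X n)
      (TwoSampleEL.response (k n) (X n) (β n) (β₂ n) (fun i => ε i ω)) (β n))
    -- `lam n ω` is a Lagrange multiplier whenever one exists (and is arbitrary otherwise)
    (lam : (n : ℕ) → Ω → EuclideanSpace ℝ (Fin (p n)))
    (hlam : ∀ n ω, (∃ l, TwoSampleEL.IsMultiplier n (k n) (Z n ω) l) →
      TwoSampleEL.IsMultiplier n (k n) (Z n ω) (lam n ω)) :
    -- the multiplier exists with probability tending to one, and has the first-order form
    Tendsto (fun n => P {ω | ¬ TwoSampleEL.IsMultiplier n (k n) (Z n ω) (lam n ω)})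
      atTop (𝓝 0) ∧
    TwoSampleEL.EqOneAddLittleOP P lam
      (fun n ω => WithLp.toLp 2 ((TwoSampleEL.V0 P n (k n) (X n) ε)⁻¹.mulVec
        (TwoSampleEL.psi n (k n)
          (TwoSampleEL.z0 (X n) (fun i => ε i ω))).ofLp)) := by
  subst hZ
  have hL : ∀ i, MemLp (ε i) 2 P := fun i => (hεident i).symm.memLp_snd hεvar
  have h0 : ∀ i, ∫ ω, ε i ω ∂P = 0 := fun i => (hεident i).integral_eq.trans hεmean
  set τ : ℝ := ∫ ω, ε 0 ω ^ 2 ∂P with hτdef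
  set κ : ℝ := ∫ ω, (ε 0 ω ^ 2 - τ) ^ 2 ∂P with hκdef
  have hτ : ∀ i, ∫ ω, ε i ω ^ 2 ∂P = τ := fun i =>
    ((hεident i).comp (u := fun x => x ^ 2) (by fun_prop)).integral_eq
  have hκ : ∀ i, ∫ ω, (ε i ω ^ 2 - τ) ^ 2 ∂P = κ := fun i =>
    ((hεident i).comp (u := fun x => (x ^ 2 - τ) ^ 2) (by fun_prop)).integral_eq
  have hL' : ∀ i, MemLp (fun ω => ε i ω ^ 2 - τ) 2 P := by
    have h4 := TwoSampleEL.integrable_pow_four_of_lintegral (hεm 0)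
      (show 4 ≤ 2 * q by linarith) (hA4.trans ENNReal.ofReal_lt_top)
    have hsq : MemLp (fun ω => ε 0 ω ^ 2) 2 P := by
      rw [memLp_two_iff_integrable_sq ((hεm 0).pow_const 2).aestronglyMeasurable]
      simpa only [← pow_mul] using h4
    exact fun i => ((hεident i).comp (u := fun x => x ^ 2 - τ) (by fun_prop)).symm.memLp_snd
      (hsq.sub (memLp_const τ))
  have hind : Pairwise fun i j => IndepFun (ε i) (ε j) P := fun i j hij => hεindep.indepFun hij
  have hphase := TwoSampleEL.eventually_abs_phaseWeight_le hθ₀ hk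
  have hr := TwoSampleEL.tendsto_dim_mul_rpow (div_nonpos_of_nonpos_of_nonneg
    (by linarith : 2 - q ≤ 0) (by linarith : 0 ≤ 2 * q))
    (hphase.mono fun n h => ⟨h.1, h.2.1.le⟩) hA5
  set W : ℝ := 2 / θ₀ + 2 / (1 - θ₀) with hW
  have hW0 : 0 < W := by
    have h1 := hθ₀.1
    have h2 : 0 < 1 - θ₀ := sub_pos.mpr hθ₀.2
    positivity
  set b : ℝ := W ^ 2 * (1 + |C₃|) with hbdef
  have hb : 0 < b := by positivity
  set v : (n : ℕ) → Ω → EuclideanSpace ℝ (Fin (p n)) := fun n ω =>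
    WithLp.toLp 2 ((TwoSampleEL.V0 P n (k n) (X n) ε)⁻¹.mulVec
      (TwoSampleEL.psi n (k n) (TwoSampleEL.z0 (X n) (fun i => ε i ω))).ofLp) with hv
  -- With no change, the residuals at the true coefficient are the errors themselves.
  simp only [H0, TwoSampleEL.z_response_self] at hlam ⊢
  -- One event carries both conclusions: existence is read off at δ = 1, the expansion at each δ.
  have key : ∀ δ : ℝ, 0 < δ → Tendsto (fun n => P {ω |
      ¬ (TwoSampleEL.IsMultiplier n (k n) (TwoSampleEL.z0 (X n) fun i => ε i ω) (lam n ω) ∧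
        ‖lam n ω - v n ω‖ ≤ δ * ‖v n ω‖)}) atTop (𝓝 0) := by
    intro δ hδ
    set K := TwoSampleEL.expansionConst C₀ (max C₁ 0) with hK
    have hK0 : 0 ≤ K := TwoSampleEL.expansionConst_nonneg hC₀ (le_max_right _ _)
    -- The first two bounds are required by the deterministic expansion; the third makes its
    -- relative error K η at most δ, with K + 1 guarding against K = 0.
    set η := min (min (C₀ / 50) 1) (δ / (K + 1)) with hη
    have hη0 : 0 < η := by positivity
    have hKη : K * η ≤ δ := by
      have h1 : η ≤ δ / (K + 1) := min_le_right _ _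
      rw [le_div_iff₀ (by positivity)] at h1
      linarith
    have hlim : Tendsto (fun n : ℕ => ENNReal.ofReal (C₄ / n + (τ + κ) * b ^ 2 / η ^ 2 *
        ((p n : ℝ) * (n : ℝ) ^ ((2 - q) / (2 * q))) ^ 2)) atTop (𝓝 0) := by
      have := ENNReal.tendsto_ofReal ((tendsto_const_div_atTop_nhds_zero_nat C₄).add
        ((hr.pow 2).const_mul ((τ + κ) * b ^ 2 / η ^ 2)))
      simpa using this
    refine tendsto_of_tendsto_of_tendsto_of_le_of_le' tendsto_const_nhds hlim
      (Eventually.of_forall fun n => zero_le) ?_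
    filter_upwards [hphase, hA1, hp.eventually_gt_atTop 0] with n hn hV hpn
    refine (measure_mono fun ω hω => ?_).trans
      (TwoSampleEL.measure_expansion_fails_le hpn hn.1 hn.2.1 (X n) (by linarith : 2 ≤ q) hεident
        hind hL h0 hτ hL' hκ hA4 hC₀ hV hη0 ((min_le_left _ _).trans (min_le_left _ _))
        ((min_le_left _ _).trans (min_le_right _ _)) hb fun i hi => ?_)
    · refine fun hgood => hω ?_
      have hl := hlam n ω hgood.1
      exact ⟨hl, (hgood.2 _ hl).trans (by gcongr)⟩
    · rw [norm_smul, mul_pow, Real.norm_eq_abs, hbdef, mul_assoc]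
      gcongr
      · exact hn.2.2 i
      · exact TwoSampleEL.norm_sq_le_of_moment hpn (by linarith) (hA3 n i hi)
  refine ⟨?_, fun δ hδ => ?_⟩
  · exact tendsto_of_tendsto_of_tendsto_of_le_of_le tendsto_const_nhds (key 1 one_pos)
      (fun n => zero_le) fun n => measure_mono fun ω hω h => hω h.1
  · exact tendsto_of_tendsto_of_tendsto_of_le_of_le tendsto_const_nhds (key δ hδ)
      (fun n => zero_le) fun n => measure_mono fun ω hω h => absurd h.2 (not_le.mpr hω)
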